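/- All functions are real-valued and $2\pi$-periodic; $\|g\|_p=\big(\int_0^{2\pi}|g(t)|^p\,dt\big)^{1/p}$ for $1\le p<\infty$, $\|g\|_\infty=\operatorname{ess\,sup}_t|g(t)|$, and $1/p=0$ for $p=\infty$. For $\alpha>0$, $r>1$ and a sequence $\bar\beta=\{\beta_k\}_{k=1}^\infty$ of real numbers, let $C^{\alpha,r}_{\bar\beta,1}$ be the class of all functions $$f(x)=\frac{a_0}{2}+\frac1\pi\int_0^{2\pi}\Psi_{\bar\beta}(x-t)\,\varphi(t)\,dt,\qquad \Psi_{\bar\beta}(t)=\sum_{k=1}^\infty e^{-\alpha k^r}\cos\Big(kt-\frac{\pi\beta_k}{2}\Big),$$ where $a_0\in\mathbb R$, $\varphi\in L_1$, $\|\varphi\|_1\le 1$ and $\int_0^{2\pi}\varphi(t)\,dt=0$. For $n\in\mathbb N=\{1,2,\dots\}$ and a continuous $f$ let $\tilde S_{n-1}(f;\cdot)$ be the trigonometric polynomial of order $n-1$ that interpolates $f$ at the nodes $x_k^{(n-1)}=\frac{2k\pi}{2n-1}$, $k\in\mathbb Z$, and put $$\tilde{\mathcal E}_n(C^{\alpha,r}_{\bar\beta,1})_{L_p}=\sup_{f\in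 C^{\alpha,r}_{\bar\beta,1}}\|f(\cdot)-\tilde S_{n-1}(f;\cdot)\|_p .$$ **Theorem.** Let $r>1$, $\alpha>0$, $1\le p\le\infty$ and $\beta_k\in\mathbb R$. Then for all $n\in\mathbb N$ such that $n^{1-r}\ln(n+1)\le\alpha r$, $$\tilde{\mathcal E}_n(C^{\alpha,r}_{\bar\beta,1})_{L_p}=e^{-\alpha n^r}\left(\frac{2^{1-\frac1p}}{\pi^{1+\frac1p}}\,\|\cos t\|_p^2+O(1)\,\frac1n\right),$$ where the quantity $O(1)$ is bounded in absolute value by an absolute constant (independent of $\alpha$, $r$, $p$, $\bar\beta$ and $n$). -/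

import Mathlib

open scoped ENNReal

namespace TrigInterp

open MeasureTheory Real

/-- Lebesgue measure on one period; all the norms `‖·‖_p` of `2π`-periodic functions are taken
with respect to it (it is not normalised, its total mass is `2π`). -/
noncomputable def periodMeasure : Measure ℝ := volume.restrict (Set.Ico 0 (2 * π))

/-- The kernel `Ψ_β(t) = ∑_{k ≥ 1} ψ(k) cos (k t - π β_k / 2)`. The values `ψ 0`, `β 0` play
no role. -/
noncomputable def kernel (ψ β : ℕ → ℝ) (t : ℝ) : ℝ :=
  ∑' k : ℕ, ψ (k + 1) * cos (((k + 1 : ℕ) : ℝ) * t - π * β (k + 1) / 2)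

/-- `φ` is a real `2π`-periodic function of the unit ball of `L_1`, orthogonal to constants. -/
structure IsAdmissible (φ : ℝ → ℝ) : Prop where
  periodic : Function.Periodic φ (2 * π)
  memLp : MemLp φ 1 periodMeasure
  norm_le : eLpNorm φ 1 periodMeasure ≤ 1
  orthogonal : ∫ t in (0 : ℝ)..(2 * π), φ t = 0

/-- The class `C^ψ_{β,1}` of convolutions
`f(x) = a₀ / 2 + (1 / π) ∫_0^{2π} Ψ_β(x - t) φ(t) dt` with `‖φ‖_1 ≤ 1`, `φ ⊥ 1`. -/
def convClass (ψ β : ℕ → ℝ) : Set (ℝ → ℝ) :=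
  {f | ∃ (a₀ : ℝ) (φ : ℝ → ℝ), IsAdmissible φ ∧
    ∀ x, f x = a₀ / 2 + (1 / π) * ∫ t in (0 : ℝ)..(2 * π), kernel ψ β (x - t) * φ t}

/-- The class `C^{α,r}_{β,1}` of generalized Poisson integrals, `ψ(k) = e^{-α k^r}`. -/
noncomputable def poissonClass (α r : ℝ) (β : ℕ → ℝ) : Set (ℝ → ℝ) :=
  convClass (fun k => exp (-α * (k : ℝ) ^ r)) β

/-- Real trigonometric polynomials of order (at most) `m`. -/
def IsTrigPoly (m : ℕ) (T : ℝ → ℝ) : Prop :=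
  ∃ (a₀ : ℝ) (a b : ℕ → ℝ), ∀ x,
    T x = a₀ / 2 + ∑ k ∈ Finset.Icc 1 m, (a k * cos (k * x) + b k * sin (k * x))

/-- The equidistant nodes `x_k^{(n-1)} = 2kπ / (2n - 1)`. -/
noncomputable def node (n : ℕ) (k : ℤ) : ℝ := 2 * (k : ℝ) * π / (2 * (n : ℝ) - 1)

/-- `T` is a trigonometric polynomial of order `n - 1` that interpolates `f` at all nodes. -/
def IsInterpolant (n : ℕ) (f T : ℝ → ℝ) : Prop :=
  IsTrigPoly (n - 1) T ∧ ∀ k : ℤ, T (node n k) = f (node n k)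

open Classical in
/-- The interpolation polynomial `S̃_{n-1}(f; ·)`: the trigonometric polynomial of order `n - 1`
interpolating `f` at the nodes. See `isInterpolant_interp` and `eq_interp` for the fact that it is
well defined for `n ≥ 1` and `2π`-periodic `f`. -/
noncomputable def interp (n : ℕ) (f : ℝ → ℝ) : ℝ → ℝ :=
  if h : ∃ T, IsInterpolant n f T then h.choose else 0

/-- The exact upper bound `sup_{f ∈ K} ‖f - S̃_{n-1}(f; ·)‖_p`, as a number in `[0, ∞]`. -/
noncomputable def interpError (n : ℕ) (p : ℝ≥0∞) (K : Set (ℝ → ℝ)) : ℝ≥0∞ :=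
  ⨆ f ∈ K, eLpNorm (fun x => f x - interp n f x) p periodMeasure

/-- `‖cos t‖_p`. -/
noncomputable def cosNorm (p : ℝ≥0∞) : ℝ := (eLpNorm cos p periodMeasure).toReal

/-! Existence and uniqueness of the interpolation polynomial. -/

lemma dirichlet_mul (m : ℕ) (y : ℝ) :
    sin (y / 2) * (1 + 2 * ∑ k ∈ Finset.Icc 1 m, cos (k * y)) = sin ((2 * m + 1) * y / 2) := by
  induction m with
  | zero => simp
  | succ m ih =>
    rw [Finset.sum_Icc_succ_top (by omega)]
    have h1 : (2 * ((m + 1 : ℕ) : ℝ) + 1) * y / 2 = ((m + 1 : ℕ) : ℝ) * y + y / 2 := by ring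
    have h2 : (2 * (m : ℝ) + 1) * y / 2 = ((m + 1 : ℕ) : ℝ) * y - y / 2 := by
      push_cast; ring
    rw [h2, sin_sub] at ih
    rw [h1, sin_add]
    linear_combination ih

lemma node_succ (m : ℕ) (k : ℤ) : node (m + 1) k = 2 * (k : ℝ) * π / (2 * (m : ℝ) + 1) := by
  unfold node; congr 1; push_cast; ring

lemma dirichlet_node (m : ℕ) (i j : Fin (2 * m + 1)) :
    1 + 2 * ∑ k ∈ Finset.Icc 1 m,
      cos (k * (node (m + 1) (i : ℕ) - node (m + 1) (j : ℕ))) =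
        if i = j then 2 * (m : ℝ) + 1 else 0 := by
  split_ifs with h
  · subst h; simp; ring
  · set y := node (m + 1) (i : ℕ) - node (m + 1) (j : ℕ) with hy
    have hN : (2 * (m : ℝ) + 1) ≠ 0 := by positivity
    have hy' : (2 * (m : ℝ) + 1) * y / 2 = (((i : ℕ) : ℤ) - ((j : ℕ) : ℤ) : ℤ) * π := by
      rw [hy, node_succ, node_succ]; push_cast; field_simp
    have h0 := dirichlet_mul m y
    rw [hy', sin_int_mul_pi] at h0
    refine (mul_eq_zero.1 h0).resolve_left fun hs => h ?_
    obtain ⟨q, hq⟩ := sin_eq_zero_iff.1 hs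
    have h1 : ((q * (2 * m + 1) : ℤ) : ℝ) * π = (((i : ℕ) : ℤ) - ((j : ℕ) : ℤ) : ℤ) * π := by
      rw [← hy']; push_cast; linear_combination (2 * (m : ℝ) + 1) * hq
    have h2 : q * (2 * m + 1) = ((i : ℕ) : ℤ) - ((j : ℕ) : ℤ) := by
      exact_mod_cast mul_right_cancel₀ pi_ne_zero h1
    have hi := i.2
    have hj := j.2
    have hq0 : q = 0 := by
      by_contra hne
      rcases lt_or_gt_of_ne hne with hlt | hgt
      · nlinarith
      · nlinarith
    subst hq0
    apply Fin.ext
    omega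

/-- Evaluation of the trigonometric polynomial with given coefficients at the nodes. -/
noncomputable def evalNodes (m : ℕ) :
    (ℝ × (Fin m → ℝ) × (Fin m → ℝ)) →ₗ[ℝ] (Fin (2 * m + 1) → ℝ) where
  toFun c i := c.1 / 2 + ∑ k : Fin m,
    (c.2.1 k * cos (((k : ℕ) + 1 : ℕ) * node (m + 1) (i : ℕ)) +
      c.2.2 k * sin (((k : ℕ) + 1 : ℕ) * node (m + 1) (i : ℕ)))
  map_add' c d := by
    ext i
    simp only [Prod.fst_add, Prod.snd_add, Pi.add_apply, add_mul, Finset.sum_add_distrib]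
    ring
  map_smul' s c := by
    ext i
    simp only [Prod.smul_fst, Prod.smul_snd, Pi.smul_apply, smul_eq_mul, RingHom.id_apply,
      mul_add, Finset.mul_sum, mul_div_assoc, mul_assoc]

lemma sum_Icc_eq_sum_fin (m : ℕ) (g : ℕ → ℝ) :
    ∑ k ∈ Finset.Icc 1 m, g k = ∑ k : Fin m, g (k + 1) := by
  rw [Fin.sum_univ_eq_sum_range (fun k => g (k + 1)) m, Finset.range_eq_Ico,
    Finset.sum_Ico_add' g 0 m 1]
  rfl

lemma evalNodes_surjective (m : ℕ) : Function.Surjective (evalNodes m) := by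
  have hN : (2 * (m : ℝ) + 1) ≠ 0 := by positivity
  intro v
  refine ⟨∑ j, (v j / (2 * m + 1)) •
    ((2, fun k => 2 * cos (((k : ℕ) + 1 : ℕ) * node (m + 1) (j : ℕ)),
      fun k => 2 * sin (((k : ℕ) + 1 : ℕ) * node (m + 1) (j : ℕ))) :
        ℝ × (Fin m → ℝ) × (Fin m → ℝ)), ?_⟩
  rw [map_sum]
  ext i
  rw [Finset.sum_apply]
  have : ∀ j : Fin (2 * m + 1), evalNodes m
      (2, fun k => 2 * cos (((k : ℕ) + 1 : ℕ) * node (m + 1) (j : ℕ)),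
        fun k => 2 * sin (((k : ℕ) + 1 : ℕ) * node (m + 1) (j : ℕ))) i =
      if i = j then 2 * (m : ℝ) + 1 else 0 := by
    intro j
    rw [← dirichlet_node, sum_Icc_eq_sum_fin, Finset.mul_sum]
    simp only [evalNodes, LinearMap.coe_mk, AddHom.coe_mk]
    congr 1
    · norm_num
    · refine Finset.sum_congr rfl fun k _ => ?_
      rw [mul_sub, cos_sub]; ring
  simp only [map_smul, Pi.smul_apply, this, smul_eq_mul, mul_ite, mul_zero,
    Finset.sum_ite_eq, Finset.mem_univ, if_true]
  field_simp

lemma evalNodes_injective (m : ℕ) : Function.Injective (evalNodes m) := by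
  refine (LinearMap.injective_iff_surjective_of_finrank_eq_finrank ?_).2 (evalNodes_surjective m)
  simp
  ring

lemma trigPoly_periodic {m : ℕ} {T : ℝ → ℝ} (hT : IsTrigPoly m T) :
    Function.Periodic T (2 * π) := by
  obtain ⟨a₀, a, b, h⟩ := hT
  intro x
  rw [h, h]
  congr 1
  refine Finset.sum_congr rfl fun k _ => ?_
  rw [mul_add, cos_add_nat_mul_two_pi, sin_add_nat_mul_two_pi]

/-- For `n ≥ 1` and `2π`-periodic `f` there is exactly one interpolation polynomial. -/
theorem existsUnique_isInterpolant {n : ℕ} (hn : 1 ≤ n) {f : ℝ → ℝ}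
    (hf : Function.Periodic f (2 * π)) : ∃! T, IsInterpolant n f T := by
  obtain ⟨m, rfl⟩ : ∃ m, n = m + 1 := ⟨n - 1, by omega⟩
  refine existsUnique_of_exists_of_unique ?_ ?_
  · obtain ⟨c, hc⟩ := evalNodes_surjective m fun i => f (node (m + 1) (i : ℕ))
    set T : ℝ → ℝ := fun x => c.1 / 2 + ∑ k ∈ Finset.Icc 1 m,
      ((if h : k - 1 < m then c.2.1 ⟨k - 1, h⟩ else 0) * cos (k * x) +
        (if h : k - 1 < m then c.2.2 ⟨k - 1, h⟩ else 0) * sin (k * x)) with hTdef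
    have hT : IsTrigPoly m T := ⟨c.1, _, _, fun x => rfl⟩
    refine ⟨T, hT, fun k => ?_⟩
    have hN : (2 * (m : ℝ) + 1) ≠ 0 := by positivity
    have hNz : (2 * (m : ℤ) + 1) ≠ 0 := by omega
    set i : ℕ := (k % (2 * m + 1)).toNat with hi
    have hi0 : ((i : ℕ) : ℤ) = k % (2 * m + 1) := Int.toNat_of_nonneg (Int.emod_nonneg _ hNz)
    have hilt : i < 2 * m + 1 := by
      have := Int.emod_lt_of_pos k (show (0 : ℤ) < 2 * m + 1 by omega)
      omega
    have hk : node (m + 1) k = node (m + 1) i + (k / (2 * m + 1) : ℤ) * (2 * π) := by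
      have h1 : (k : ℝ) = (((i : ℕ) : ℤ) : ℝ) + (2 * m + 1) * ((k / (2 * m + 1) : ℤ) : ℝ) := by
        have := Int.emod_add_mul_ediv k (2 * m + 1)
        rw [← hi0] at this
        exact_mod_cast this.symm
      rw [node_succ, node_succ, h1]
      field_simp
    rw [hk, (trigPoly_periodic hT).int_mul, hf.int_mul]
    have h2 := congrFun hc ⟨i, hilt⟩
    simp only at h2
    rw [← h2, hTdef]
    simp only [evalNodes, LinearMap.coe_mk, AddHom.coe_mk, sum_Icc_eq_sum_fin]
    congr 1
    refine Finset.sum_congr rfl fun k _ => ?_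
    simp
  · rintro T₁ T₂ ⟨⟨a₁, b₁, c₁, h₁⟩, e₁⟩ ⟨⟨a₂, b₂, c₂, h₂⟩, e₂⟩
    have key : evalNodes m (a₁, fun k => b₁ (k + 1), fun k => c₁ (k + 1)) =
        evalNodes m (a₂, fun k => b₂ (k + 1), fun k => c₂ (k + 1)) := by
      ext i
      have := (e₁ (i : ℕ)).trans (e₂ (i : ℕ)).symm
      rw [h₁, h₂, sum_Icc_eq_sum_fin, sum_Icc_eq_sum_fin] at this
      exact this
    have := evalNodes_injective m key
    simp only [Prod.mk.injEq] at this
    obtain ⟨ha, hb, hc⟩ := this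
    funext x
    rw [h₁, h₂, sum_Icc_eq_sum_fin, sum_Icc_eq_sum_fin, ha]
    congr 1
    refine Finset.sum_congr rfl fun k _ => ?_
    rw [congrFun hb k, congrFun hc k]

theorem isInterpolant_interp {n : ℕ} (hn : 1 ≤ n) {f : ℝ → ℝ}
    (hf : Function.Periodic f (2 * π)) : IsInterpolant n f (interp n f) := by
  have h := (existsUnique_isInterpolant hn hf).exists
  unfold interp
  rw [dif_pos h]
  exact h.choose_spec

theorem eq_interp {n : ℕ} (hn : 1 ≤ n) {f T : ℝ → ℝ}
    (hf : Function.Periodic f (2 * π)) (hT : IsInterpolant n f T) : T = interp n f :=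
  (existsUnique_isInterpolant hn hf).unique hT (isInterpolant_interp hn hf)

end TrigInterp

/-!
Interpolation at the `2n - 1` equidistant nodes cannot tell the frequency `k` from its signed residue
modulo `2n - 1`. Hence it reproduces the harmonics below `n`, and the error of a function of the
class splits into the error of the `n`-th harmonic and a remainder (`abs_error_sub_le`). The condition
on `n` makes `e^{-αk^r}` decay with ratio at most `1 / (n + 1)` from `k = n` on, so the remainder is
uniformly `O(e^{-αn^r} / n)` (`tsum_exp_neg_rpow_le`).

With `N = 2n - 1`, the error of the `n`-th harmonic is
`(2 / π) e^{-αn^r} ρ sin(Nx/2) sin(x/2 + θ)`, where `θ` is a phase and `ρ ≤ 1` the modulus of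
the integral of `φ(t) e^{int}` (`exists_profile_approx`). Normalised high odd powers of a
shifted `cos(nt)` are admissible and have `ρ ≥ 1 - 1/n` (`cosCoeff_nearExtremal`), so the supremum
over `φ` amounts to `ρ = 1` up to `O(1/n)`.

What remains is that the `L_p` norm of the profile `sin(Nx/2) sin(x/2 + θ)` equals
`(2π)^{-1/p} ‖cos‖_p²` up to `O(1/n)`, uniformly in `p` and `θ` (`abs_perNorm_profile_sub_le`). For
`p < ∞`, averaging the `p`-th power of this norm over `θ` decouples the two factors and gives exactly
`‖cos‖_p^{2p} / (2π)`. The norm is Lipschitz in `θ`, with a constant independent of `p`, and has the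
period `π / N` in `θ`, so it stays within `O(1/N)` of its mean. For `p = ∞` the profile comes within
`O(1/N)` of modulus `1` at the extremum of the fast factor next to the maximum of the slow one.
-/

namespace TrigInterp

open MeasureTheory Real

/-! ### Norms over one period -/

lemma periodMeasure_univ : periodMeasure Set.univ = ENNReal.ofReal (2 * π) := by
  simp [periodMeasure]

instance : IsFiniteMeasure periodMeasure :=
  ⟨by rw [periodMeasure_univ]; exact ENNReal.ofReal_lt_top⟩

lemma integral_periodMeasure (F : ℝ → ℝ) :
    ∫ x, F x ∂periodMeasure = ∫ x in (0 : ℝ)..(2 * π), F x := by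
  rw [intervalIntegral.integral_of_le two_pi_pos.le, integral_Ioc_eq_integral_Ioo, periodMeasure,
    integral_Ico_eq_integral_Ioo]

/-- The constant `2π` bounds `(2π)^{1/p}` for every `p ≥ 1`, which keeps it independent of `p`. -/
lemma eLpNorm_le_of_abs_le {p : ℝ≥0∞} (hp : 1 ≤ p) {F : ℝ → ℝ} {K : ℝ}
    (h : ∀ x, |F x| ≤ K) : eLpNorm F p periodMeasure ≤ ENNReal.ofReal (2 * π * K) := by
  refine (eLpNorm_le_of_ae_bound (C := K) (Filter.Eventually.of_forall h)).trans ?_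
  rw [periodMeasure_univ, ENNReal.ofReal_mul two_pi_pos.le]
  gcongr
  have h1 : (1 : ℝ≥0∞) ≤ ENNReal.ofReal (2 * π) := by
    rw [ENNReal.one_le_ofReal]; linarith [pi_gt_three]
  have h2 : p.toReal⁻¹ ≤ 1 := by
    rcases eq_or_ne p ∞ with rfl | hpt
    · simp
    · have := ENNReal.toReal_mono hpt hp
      simp only [ENNReal.toReal_one] at this
      exact inv_le_one_of_one_le₀ this
  calc _ ≤ ENNReal.ofReal (2 * π) ^ (1 : ℝ) := ENNReal.rpow_le_rpow_of_exponent_le h1 h2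
    _ = _ := ENNReal.rpow_one _

/-- The `L_p` norm over one period as a real number; it is meaningful only for functions with
finite norm, in particular for bounded ones. -/
noncomputable def perNorm (p : ℝ≥0∞) (F : ℝ → ℝ) : ℝ := (eLpNorm F p periodMeasure).toReal

lemma perNorm_nonneg (p : ℝ≥0∞) (F : ℝ → ℝ) : 0 ≤ perNorm p F := ENNReal.toReal_nonneg

lemma perNorm_le_of_abs_le {p : ℝ≥0∞} (hp : 1 ≤ p) {F : ℝ → ℝ} {K : ℝ}
    (h : ∀ x, |F x| ≤ K) : perNorm p F ≤ 2 * π * K := by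
  have hK : 0 ≤ K := (abs_nonneg _).trans (h 0)
  exact ENNReal.toReal_le_of_le_ofReal (by positivity) (eLpNorm_le_of_abs_le hp h)

lemma eLpNorm_ne_top_of_abs_le {p : ℝ≥0∞} (hp : 1 ≤ p) {F : ℝ → ℝ} {K : ℝ}
    (h : ∀ x, |F x| ≤ K) : eLpNorm F p periodMeasure ≠ ∞ :=
  ((eLpNorm_le_of_abs_le hp h).trans_lt ENNReal.ofReal_lt_top).ne

/-- If two continuous functions differ by at most `K` everywhere, then their norms differ by at
most `2πK`. -/
lemma perNorm_le_add {p : ℝ≥0∞} (hp : 1 ≤ p) {F G : ℝ → ℝ} (hF : Continuous F)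
    (hG : Continuous G) {K K' : ℝ} (hGK : ∀ x, |G x| ≤ K') (h : ∀ x, |F x - G x| ≤ K) :
    perNorm p F ≤ perNorm p G + 2 * π * K := by
  have h1 : eLpNorm F p periodMeasure ≤
      eLpNorm G p periodMeasure + eLpNorm (fun x => F x - G x) p periodMeasure := by
    have := eLpNorm_add_le (μ := periodMeasure) hG.aestronglyMeasurable
      (hF.sub hG).aestronglyMeasurable hp
    rwa [add_sub_cancel] at this
  have h2 := ENNReal.toReal_mono (ENNReal.add_ne_top.2
    ⟨eLpNorm_ne_top_of_abs_le hp hGK, eLpNorm_ne_top_of_abs_le hp h⟩) h1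
  rw [ENNReal.toReal_add (eLpNorm_ne_top_of_abs_le hp hGK) (eLpNorm_ne_top_of_abs_le hp h)] at h2
  exact h2.trans (add_le_add_right (perNorm_le_of_abs_le hp h) _)

lemma perNorm_const_mul (p : ℝ≥0∞) (c : ℝ) (F : ℝ → ℝ) :
    perNorm p (fun x => c * F x) = |c| * perNorm p F := by
  have := eLpNorm_const_smul c F p periodMeasure
  unfold perNorm
  rw [show (fun x => c * F x) = c • F from rfl, this]
  simp

lemma perNorm_rpow {p : ℝ≥0∞} (hp : 1 ≤ p) (hpt : p ≠ ∞) {F : ℝ → ℝ} (hF : Continuous F)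
    {K : ℝ} (h : ∀ x, |F x| ≤ K) :
    perNorm p F ^ p.toReal = ∫ x in (0 : ℝ)..(2 * π), |F x| ^ p.toReal := by
  have hp0 : p ≠ 0 := (zero_lt_one.trans_le hp).ne'
  have hm : MemLp F p periodMeasure :=
    ⟨hF.aestronglyMeasurable, (eLpNorm_ne_top_of_abs_le hp h).lt_top⟩
  have hnn : 0 ≤ ∫ x, ‖F x‖ ^ p.toReal ∂periodMeasure :=
    integral_nonneg fun x => by positivity
  rw [perNorm, hm.eLpNorm_eq_integral_rpow_norm hp0 hpt,
    ENNReal.toReal_ofReal (by positivity), ← rpow_mul hnn,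
    inv_mul_cancel₀ (ENNReal.toReal_pos hp0 hpt).ne', rpow_one, integral_periodMeasure]
  rfl

lemma abs_le_perNorm_top {F : ℝ → ℝ} (hF : Continuous F) {K : ℝ} (h : ∀ x, |F x| ≤ K)
    (hper : Function.Periodic (fun x => |F x|) (2 * π)) (x : ℝ) : |F x| ≤ perNorm ∞ F := by
  obtain ⟨y, hy, hxy⟩ := hper.exists_mem_Ico₀ two_pi_pos x
  have hxy : |F x| = |F y| := hxy
  rw [hxy]
  have hae : ∀ᵐ x ∂periodMeasure, |F x| ≤ perNorm ∞ F := by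
    have := ae_le_eLpNormEssSup (f := F) (μ := periodMeasure)
    filter_upwards [this] with x hx
    have hx2 := ENNReal.toReal_mono (eLpNorm_ne_top_of_abs_le (p := ∞) le_top h) hx
    rwa [toReal_enorm] at hx2
  have heq : (fun x => max |F x| (perNorm ∞ F)) =ᵐ[volume.restrict (Set.Ico 0 (2 * π))]
      fun _ => perNorm ∞ F := by
    filter_upwards [hae] with x hx
    exact max_eq_right hx
  have := Measure.eqOn_Ico_of_ae_eq volume heq (by fun_prop) (by fun_prop) hy
  exact max_eq_right_iff.1 this

/-! ### The norm of the leading term -/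

lemma integral_comp_half_mul_add {G : ℝ → ℝ} (hG : Continuous G) (hper : Function.Periodic G π)
    {N : ℕ} (hN : 1 ≤ N) (θ : ℝ) :
    ∫ x in (0 : ℝ)..(2 * π), G (N * x / 2 + θ) = ∫ x in (0 : ℝ)..(2 * π), G x := by
  have hN0 : (N : ℝ) ≠ 0 := by positivity
  have hi : ∀ t₁ t₂ : ℝ, IntervalIntegrable G volume t₁ t₂ := fun _ _ => hG.intervalIntegrable _ _
  have h1 := intervalIntegral.integral_comp_mul_add (a := 0) (b := 2 * π) G
    (c := (N : ℝ) / 2) (by positivity) θ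
  have h2 := hper.intervalIntegral_add_zsmul_eq N θ hi
  have h3 := hper.intervalIntegral_add_zsmul_eq 2 0 hi
  have h4 := hper.intervalIntegral_add_eq θ 0
  have e1 : (N : ℝ) / 2 * 0 + θ = θ := by ring
  have e2 : (N : ℝ) / 2 * (2 * π) + θ = θ + (N : ℤ) • π := by simp; ring
  have e3 : (0 : ℝ) + (2 : ℤ) • π = 2 * π := by simp
  rw [e1, e2, h2, h4] at h1
  rw [e3] at h3
  simp only [mul_div_right_comm]
  rw [h1, h3]
  simp only [zsmul_eq_mul, smul_eq_mul]
  push_cast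
  field_simp

/-- The profile of the `n`-th harmonic of the interpolation error, with `N = 2n - 1`. -/
noncomputable def profile (N : ℕ) (θ x : ℝ) : ℝ := sin (N * x / 2) * sin (x / 2 + θ)

lemma continuous_profile (N : ℕ) (θ : ℝ) : Continuous (profile N θ) := by
  unfold profile; fun_prop

lemma abs_profile_le (N : ℕ) (θ x : ℝ) : |profile N θ x| ≤ 1 := by
  rw [profile, abs_mul]
  exact mul_le_one₀ (abs_sin_le_one _) (abs_nonneg _) (abs_sin_le_one _)

lemma perNorm_profile_le {p : ℝ≥0∞} (hp : 1 ≤ p) (N : ℕ) (θ : ℝ) :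
    perNorm p (profile N θ) ≤ 2 * π := by
  simpa using perNorm_le_of_abs_le hp (abs_profile_le N θ)

lemma abs_sin_sub_sin_le (x y : ℝ) : |sin x - sin y| ≤ |x - y| := by
  rw [sin_sub_sin, abs_mul, abs_mul, abs_two]
  have h1 := abs_sin_le_abs (x := (x - y) / 2)
  have h2 := abs_cos_le_one ((x + y) / 2)
  rw [abs_div, abs_two] at h1
  nlinarith [abs_nonneg (sin ((x - y) / 2)), abs_nonneg (cos ((x + y) / 2))]

lemma abs_profile_sub_le (N : ℕ) (θ θ' x : ℝ) :
    |profile N θ x - profile N θ' x| ≤ |θ - θ'| := by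
  unfold profile
  rw [← mul_sub, abs_mul]
  have h1 := abs_sin_sub_sin_le (x / 2 + θ) (x / 2 + θ')
  rw [show x / 2 + θ - (x / 2 + θ') = θ - θ' by ring] at h1
  nlinarith [abs_sin_le_one (N * x / 2), abs_nonneg (sin (N * x / 2)),
    abs_nonneg (sin (x / 2 + θ) - sin (x / 2 + θ'))]

lemma periodic_abs_profile (N : ℕ) (θ : ℝ) :
    Function.Periodic (fun x => |profile N θ x|) (2 * π) := by
  intro x
  simp only [profile, abs_mul]
  congr 1
  · rw [show (N : ℝ) * (x + 2 * π) / 2 = N * x / 2 + N * π by ring, sin_add_nat_mul_pi, abs_mul]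
    simp
  · rw [show (x + 2 * π) / 2 + θ = x / 2 + θ + π by ring, sin_add_pi, abs_neg]

/-- A phase shift by `π / N` amounts to a translation of `x` by a half-period of the oscillating
factor. -/
lemma abs_profile_add (N : ℕ) (hN : 1 ≤ N) (θ x : ℝ) :
    |profile N (θ + π / N) x| = |profile N θ (x + 2 * π / N)| := by
  have hN0 : (N : ℝ) ≠ 0 := by positivity
  simp only [profile, abs_mul]
  rw [show (N : ℝ) * (x + 2 * π / N) / 2 = N * x / 2 + π by field_simp, sin_add_pi, abs_neg,
    show (x + 2 * π / N) / 2 + θ = x / 2 + (θ + π / N) by ring]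

lemma perNorm_profile_periodic {p : ℝ≥0∞} (hp : 1 ≤ p) (hpt : p ≠ ∞) {N : ℕ} (hN : 1 ≤ N) :
    Function.Periodic (fun θ => perNorm p (profile N θ)) (π / N) := by
  intro θ
  have hq : 0 < p.toReal := ENNReal.toReal_pos (zero_lt_one.trans_le hp).ne' hpt
  refine (rpow_left_injOn hq.ne') (perNorm_nonneg _ _) (perNorm_nonneg _ _) ?_
  change perNorm p (profile N (θ + π / N)) ^ p.toReal = perNorm p (profile N θ) ^ p.toReal
  rw [perNorm_rpow hp hpt (continuous_profile _ _) (abs_profile_le _ _),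
    perNorm_rpow hp hpt (continuous_profile _ _) (abs_profile_le _ _)]
  simp only [abs_profile_add N hN]
  rw [intervalIntegral.integral_comp_add_right (fun x => |profile N θ x| ^ p.toReal)]
  have hper : Function.Periodic (fun x => |profile N θ x| ^ p.toReal) (2 * π) :=
    (periodic_abs_profile N θ).comp (fun y => y ^ p.toReal)
  have := hper.intervalIntegral_add_eq (0 + 2 * π / N) 0
  rw [zero_add (2 * π)] at this
  rw [← this]
  congr 1
  ring

lemma perNorm_profile_sub_le {p : ℝ≥0∞} (hp : 1 ≤ p) (hpt : p ≠ ∞) {N : ℕ} (hN : 1 ≤ N)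
    (θ θ' : ℝ) : perNorm p (profile N θ) ≤ perNorm p (profile N θ') + 2 * π * (π / N) := by
  have hN0 : (0 : ℝ) < N := by positivity
  obtain ⟨θ₁, h1, h2⟩ := (perNorm_profile_periodic hp hpt hN).exists_mem_Ico
    (div_pos pi_pos hN0) θ θ'
  rw [h2]
  refine perNorm_le_add hp (continuous_profile _ _) (continuous_profile _ _)
    (abs_profile_le _ _) fun x => (abs_profile_sub_le _ _ _ _).trans ?_
  rw [abs_le]
  constructor <;> linarith [h1.1, h1.2]

/-- Averaging over the phase decouples the two factors of the profile. -/
lemma integral_perNorm_profile {p : ℝ≥0∞} (hp : 1 ≤ p) (hpt : p ≠ ∞) {N : ℕ} (hN : 1 ≤ N) :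
    ∫ θ in (0 : ℝ)..(2 * π), perNorm p (profile N θ) ^ p.toReal =
      (cosNorm p ^ p.toReal) ^ 2 := by
  have hq : 0 ≤ p.toReal := ENNReal.toReal_nonneg
  have hc : cosNorm p ^ p.toReal = ∫ x in (0 : ℝ)..(2 * π), |cos x| ^ p.toReal :=
    perNorm_rpow hp hpt continuous_cos abs_cos_le_one
  set G : ℝ → ℝ := fun x => |cos x| ^ p.toReal with hG
  have hGc : Continuous G := continuous_cos.abs.rpow_const fun _ => Or.inr hq
  have hGp : Function.Periodic G π := fun x => by simp only [hG, cos_add_pi, abs_neg]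
  have hsin : ∀ y, |sin y| ^ p.toReal = G (y - π / 2) := fun y => by
    simp only [hG, cos_sub_pi_div_two]
  have hJ : ∀ θ, perNorm p (profile N θ) ^ p.toReal =
      ∫ x in (0 : ℝ)..(2 * π), G (N * x / 2 + -(π / 2)) * G (x / 2 + θ - π / 2) := by
    intro θ
    rw [perNorm_rpow hp hpt (continuous_profile _ _) (abs_profile_le _ _)]
    refine intervalIntegral.integral_congr fun x _ => ?_
    simp only [profile, abs_mul, mul_rpow (abs_nonneg _) (abs_nonneg _), hsin, sub_eq_add_neg]
  simp only [hJ, hc]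
  rw [intervalIntegral_intervalIntegral_swap]
  · have : ∀ x, ∫ θ in (0 : ℝ)..(2 * π), G (N * x / 2 + -(π / 2)) * G (x / 2 + θ - π / 2) =
        G (N * x / 2 + -(π / 2)) * ∫ x in (0 : ℝ)..(2 * π), G x := by
      intro x
      rw [intervalIntegral.integral_const_mul]
      congr 1
      have h1 := integral_comp_half_mul_add hGc hGp (N := 2) (by norm_num) (x / 2 - π / 2)
      rw [← h1]
      refine intervalIntegral.integral_congr fun θ _ => ?_
      exact congrArg G (by push_cast; ring)
    simp only [this]
    rw [intervalIntegral.integral_mul_const, integral_comp_half_mul_add hGc hGp hN, sq]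
  · refine (Continuous.integrableOn_Icc (a := ((0 : ℝ), (0 : ℝ))) (b := (2 * π, 2 * π))
      ?_).mono_set ?_
    · refine Continuous.mul ?_ ?_ <;> exact hGc.comp (by fun_prop)
    · rw [Set.uIoc_of_le two_pi_pos.le, Set.Icc_prod_eq]
      exact Set.prod_mono Set.Ioc_subset_Icc_self Set.Ioc_subset_Icc_self

/-- The norm of the profile is, up to `O(1/N)` and uniformly in the phase and in `p`, equal to
`(2π)^{-1/p} ‖cos‖_p²`: its `p`-th power has exactly that mean over all phases, and the norm varies
by `O(1/N)` only. -/
lemma abs_perNorm_profile_sub_le_of_ne_top {p : ℝ≥0∞} (hp : 1 ≤ p) (hpt : p ≠ ∞) {N : ℕ}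
    (hN : 1 ≤ N) (θ : ℝ) :
    |perNorm p (profile N θ) - cosNorm p ^ 2 / (2 * π) ^ (p⁻¹).toReal| ≤ 2 * π * (π / N) := by
  have hq : 0 < p.toReal := ENNReal.toReal_pos (zero_lt_one.trans_le hp).ne' hpt
  have hcn : 0 ≤ cosNorm p := ENNReal.toReal_nonneg
  have hpi := two_pi_pos
  set D := 2 * π * (π / N) with hD
  have hD0 : 0 ≤ D := by positivity
  set M := cosNorm p ^ 2 / (2 * π) ^ (p⁻¹).toReal with hM
  have hM0 : 0 ≤ M := by positivity
  have hMq : 2 * π * M ^ p.toReal = (cosNorm p ^ p.toReal) ^ 2 := by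
    rw [hM, div_rpow (by positivity) (by positivity), ← rpow_mul hpi.le, ENNReal.toReal_inv,
      inv_mul_cancel₀ hq.ne', rpow_one, ← rpow_natCast, ← rpow_natCast, ← rpow_mul hcn,
      ← rpow_mul hcn, mul_comm p.toReal]
    field_simp
  have hcont : Continuous fun θ => perNorm p (profile N θ) ^ p.toReal := by
    have : ∀ θ, perNorm p (profile N θ) ^ p.toReal =
        ∫ x in (0 : ℝ)..(2 * π), |profile N θ x| ^ p.toReal := fun θ =>
      perNorm_rpow hp hpt (continuous_profile _ _) (abs_profile_le _ _)
    simp only [this]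
    refine intervalIntegral.continuous_parametric_intervalIntegral_of_continuous' ?_ _ _
    refine Continuous.rpow_const ?_ fun _ => Or.inr hq.le
    simp only [profile]
    fun_prop
  have hint : ∀ a b : ℝ, IntervalIntegrable (fun θ => perNorm p (profile N θ) ^ p.toReal)
    volume a b := fun a b => hcont.intervalIntegrable a b
  have havg := integral_perNorm_profile hp hpt hN
  rw [← hMq] at havg
  rw [abs_le]
  constructor
  · have h1 : ∫ θ' in (0 : ℝ)..(2 * π), perNorm p (profile N θ') ^ p.toReal ≤
        ∫ _ in (0 : ℝ)..(2 * π), (perNorm p (profile N θ) + D) ^ p.toReal :=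
      intervalIntegral.integral_mono_on hpi.le (hint _ _) intervalIntegrable_const fun θ' _ =>
        rpow_le_rpow (perNorm_nonneg _ _) (perNorm_profile_sub_le hp hpt hN θ' θ) hq.le
    rw [havg, intervalIntegral.integral_const, sub_zero, smul_eq_mul] at h1
    have h2 := le_of_mul_le_mul_left h1 hpi
    have h3 := (rpow_le_rpow_iff hM0 (add_nonneg (perNorm_nonneg _ _) hD0) hq).1 h2
    linarith
  · by_cases hle : perNorm p (profile N θ) ≤ D
    · linarith
    push Not at hle
    have h1 : ∫ _ in (0 : ℝ)..(2 * π), (perNorm p (profile N θ) - D) ^ p.toReal ≤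
        ∫ θ' in (0 : ℝ)..(2 * π), perNorm p (profile N θ') ^ p.toReal :=
      intervalIntegral.integral_mono_on hpi.le intervalIntegrable_const (hint _ _) fun θ' _ =>
        rpow_le_rpow (by linarith)
          (by linarith [perNorm_profile_sub_le hp hpt hN θ θ']) hq.le
    rw [havg, intervalIntegral.integral_const, sub_zero, smul_eq_mul] at h1
    have h2 := le_of_mul_le_mul_left h1 hpi
    have h3 := (rpow_le_rpow_iff (by linarith) hM0 hq).1 h2
    linarith

lemma cosNorm_top : cosNorm ∞ = 1 := by
  have hper : Function.Periodic (fun x => |cos x|) (2 * π) := fun x => by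
    simp only [cos_add_two_pi]
  refine le_antisymm ?_ ?_
  · refine ENNReal.toReal_le_of_le_ofReal zero_le_one ?_
    simpa using eLpNorm_le_of_ae_bound (p := ∞) (μ := periodMeasure) (f := cos) (C := 1)
      (Filter.Eventually.of_forall abs_cos_le_one)
  · have := abs_le_perNorm_top continuous_cos abs_cos_le_one hper 0
    rwa [cos_zero, abs_one] at this

lemma abs_perNorm_top_profile_sub_le {N : ℕ} (hN : 1 ≤ N) (θ : ℝ) :
    |perNorm ∞ (profile N θ) - 1| ≤ π / N := by
  have hN0 : (0 : ℝ) < N := by positivity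
  have hub : perNorm ∞ (profile N θ) ≤ 1 := by
    refine ENNReal.toReal_le_of_le_ofReal zero_le_one ?_
    simpa using eLpNorm_le_of_ae_bound (p := ∞) (μ := periodMeasure) (f := profile N θ) (C := 1)
      (Filter.Eventually.of_forall (abs_profile_le N θ))
  -- The slow factor attains its maximum at `y`; the fast one has modulus `1` at the point `x`,
  -- which lies within `π / N` of `y`.
  set y := π - 2 * θ with hy
  set j := ⌊N * y / (2 * π)⌋ with hj
  set x := (2 * j + 1) * π / N with hx
  have h1 : |sin (N * x / 2)| = 1 := by
    rw [show N * x / 2 = j * π + π / 2 by rw [hx]; field_simp, sin_add_pi_div_two,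
      abs_cos_int_mul_pi]
  have h2 : |x / 2 + θ - π / 2| ≤ π / N := by
    have hj1 := Int.floor_le (N * y / (2 * π))
    have hj2 := Int.lt_floor_add_one (N * y / (2 * π))
    rw [← hj] at hj1 hj2
    rw [le_div_iff₀ two_pi_pos] at hj1
    rw [div_lt_iff₀ two_pi_pos] at hj2
    have e : x / 2 + θ - π / 2 = ((2 * j + 1) * π - N * y) / (2 * N) := by
      rw [hx, hy]; field_simp; ring
    rw [e, abs_div, abs_of_pos (show (0 : ℝ) < 2 * N by positivity), div_le_div_iff₀ (by positivity)
      hN0]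
    have : |(2 * j + 1) * π - N * y| ≤ π := by
      rw [abs_le]; constructor <;> linarith
    nlinarith [pi_pos]
  have h3 : 1 - π / N ≤ |profile N θ x| := by
    rw [profile, abs_mul, h1, one_mul]
    have := (abs_sin_sub_sin_le (x / 2 + θ) (π / 2)).trans h2
    rw [sin_pi_div_two] at this
    have h4 := (abs_le.1 this).1
    exact (by linarith : 1 - π / N ≤ sin (x / 2 + θ)).trans (le_abs_self _)
  have h5 := abs_le_perNorm_top (continuous_profile N θ) (abs_profile_le N θ)
    (periodic_abs_profile N θ) x
  have : 0 ≤ π / N := by positivity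
  rw [abs_le]
  constructor <;> linarith

lemma abs_perNorm_profile_sub_le {p : ℝ≥0∞} (hp : 1 ≤ p) {N : ℕ} (hN : 1 ≤ N) (θ : ℝ) :
    |perNorm p (profile N θ) - cosNorm p ^ 2 / (2 * π) ^ (p⁻¹).toReal| ≤ 2 * π * (π / N) := by
  rcases eq_or_ne p ∞ with rfl | hpt
  · have h := abs_perNorm_top_profile_sub_le hN θ
    simp only [cosNorm_top, ENNReal.inv_top, ENNReal.toReal_zero, rpow_zero]
    have : 0 ≤ π / N := by positivity
    norm_num at h ⊢
    nlinarith [pi_gt_three]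
  · exact abs_perNorm_profile_sub_le_of_ne_top hp hpt hN θ

/-! ### Interpolation of trigonometric series -/

/-- The signed residue of `k` modulo `2n - 1`, which lies in `[-(n - 1), n - 1]`: the frequency that
the `k`-th harmonic is mistaken for at the nodes. -/
def aliasFreq (n k : ℕ) : ℤ := Int.bmod k (2 * n - 1)

lemma natAbs_aliasFreq_le {n : ℕ} (hn : 1 ≤ n) (k : ℕ) : (aliasFreq n k).natAbs ≤ n - 1 := by
  have h1 := Int.le_bmod (x := k) (m := 2 * n - 1) (by omega)
  have h2 := Int.bmod_lt (x := k) (m := 2 * n - 1) (by omega)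
  unfold aliasFreq
  omega

lemma aliasFreq_of_lt {n k : ℕ} (hk : k < n) : aliasFreq n k = k := by
  unfold aliasFreq
  apply Int.bmod_eq_of_le <;> omega

lemma aliasFreq_self {n : ℕ} (hn : 1 ≤ n) : aliasFreq n n = -((n - 1 : ℕ) : ℤ) := by
  have h : ((n : ℕ) : ℤ) = -((n - 1 : ℕ) : ℤ) + ((2 * n - 1 : ℕ) : ℤ) := by omega
  rw [aliasFreq, h, Int.add_bmod_right]
  apply Int.bmod_eq_of_le <;> omega

lemma mul_node_eq {n : ℕ} (hn : 1 ≤ n) (k : ℕ) (i : ℤ) :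
    ∃ q : ℤ, (k : ℝ) * node n i = aliasFreq n k * node n i + q * (2 * π) := by
  refine ⟨Int.bdiv k (2 * n - 1) * i, ?_⟩
  have h : (aliasFreq n k : ℝ) = k - (2 * n - 1) * (Int.bdiv k (2 * n - 1) : ℝ) := by
    have := Int.bmod_eq_self_sub_mul_bdiv k (2 * n - 1)
    rw [aliasFreq, this]
    push_cast [Nat.cast_sub (show 1 ≤ 2 * n by omega)]
    ring
  have hN : (2 * (n : ℝ) - 1) ≠ 0 := by
    have : (1 : ℝ) ≤ n := by exact_mod_cast hn
    linarith
  rw [h, node]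
  push_cast
  field_simp
  ring

lemma cos_int_mul_eq (j : ℤ) (x : ℝ) : cos (j * x) = cos (j.natAbs * x) := by
  rw [Nat.cast_natAbs, Int.cast_abs]
  rcases abs_choice (j : ℝ) with h | h <;> rw [h]
  rw [neg_mul, cos_neg]

lemma sin_int_mul_eq (j : ℤ) (x : ℝ) : sin (j * x) = j.sign * sin (j.natAbs * x) := by
  rcases lt_trichotomy j 0 with h | rfl | h
  · rw [Int.sign_eq_neg_one_of_neg h, Nat.cast_natAbs, abs_of_neg h]
    push_cast
    rw [show -(j : ℝ) * x = -(j * x) by ring, sin_neg]; ring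
  · simp
  · rw [Int.sign_eq_one_of_pos h, Nat.cast_natAbs, abs_of_pos h]
    simp

lemma abs_harmonic_le (a b y : ℝ) : |a * cos y + b * sin y| ≤ |a| + |b| := by
  refine (abs_add_le _ _).trans (add_le_add ?_ ?_)
  · rw [abs_mul]; exact mul_le_of_le_one_right (abs_nonneg _) (abs_cos_le_one _)
  · rw [abs_mul]; exact mul_le_of_le_one_right (abs_nonneg _) (abs_sin_le_one _)

lemma summable_harmonic {u v : ℕ → ℝ} (hu : Summable fun k => |u k|)
    (hv : Summable fun k => |v k|) (y : ℕ → ℝ) :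
    Summable fun k => u k * cos (y k) + v k * sin (y k) := by
  exact Summable.of_norm_bounded (hu.add hv) fun k => abs_harmonic_le _ _ _

lemma isTrigPoly_tsum {m : ℕ} {u v : ℕ → ℝ} (hu : Summable fun k => |u k|)
    (hv : Summable fun k => |v k|) (a₀ : ℝ) {j : ℕ → ℤ} (hj : ∀ k, (j k).natAbs ≤ m) :
    IsTrigPoly m fun x => a₀ / 2 + ∑' k, (u k * cos (j k * x) + v k * sin (j k * x)) := by
  have hA : ∀ (P : ℕ → Prop) [DecidablePred P], Summable fun k => if P k then u k else 0 :=
    fun P _ => Summable.of_norm_bounded hu fun k => by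
      split_ifs
      · exact le_rfl
      · simp
  have hB : ∀ (P : ℕ → Prop) [DecidablePred P],
      Summable fun k => if P k then ((j k).sign : ℝ) * v k else 0 :=
    fun P _ => Summable.of_norm_bounded hv fun k => by
      split_ifs
      · rw [norm_mul]
        refine mul_le_of_le_one_left (abs_nonneg _) ?_
        rw [norm_eq_abs]
        rcases lt_trichotomy (j k) 0 with h | h | h
        · simp [Int.sign_eq_neg_one_of_neg h]
        · simp [h]
        · simp [Int.sign_eq_one_of_pos h]
      · simp
  refine ⟨a₀ + 2 * ∑' k, (if j k = 0 then u k else 0),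
    fun i => ∑' k, (if (j k).natAbs = i then u k else 0),
    fun i => ∑' k, (if (j k).natAbs = i then ((j k).sign : ℝ) * v k else 0), fun x => ?_⟩
  have key : ∀ k, u k * cos (j k * x) + v k * sin (j k * x) = (if j k = 0 then u k else 0) +
      ∑ i ∈ Finset.Icc 1 m, ((if (j k).natAbs = i then u k else 0) * cos (i * x) +
        (if (j k).natAbs = i then ((j k).sign : ℝ) * v k else 0) * sin (i * x)) := by
    intro k
    simp only [ite_mul, zero_mul, Finset.sum_add_distrib, Finset.sum_ite_eq]
    by_cases h : j k = 0
    · simp [h]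
    · have : (j k).natAbs ∈ Finset.Icc 1 m := by
        rw [Finset.mem_Icc]; exact ⟨by omega, hj k⟩
      rw [if_pos this, if_pos this, if_neg h, cos_int_mul_eq, sin_int_mul_eq]
      ring
  have hs : ∀ i ∈ Finset.Icc 1 m, Summable fun k =>
      ((if (j k).natAbs = i then u k else 0) * cos (i * x) +
        (if (j k).natAbs = i then ((j k).sign : ℝ) * v k else 0) * sin (i * x)) :=
    fun i _ => ((hA _).mul_right _).add ((hB _).mul_right _)
  simp only [key]
  rw [(hA _).tsum_add (summable_sum hs), Summable.tsum_finsetSum hs]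
  have : ∀ i : ℕ, ∑' k, ((if (j k).natAbs = i then u k else 0) * cos (i * x) +
        (if (j k).natAbs = i then ((j k).sign : ℝ) * v k else 0) * sin (i * x)) =
      (∑' k, (if (j k).natAbs = i then u k else 0)) * cos (i * x) +
        (∑' k, (if (j k).natAbs = i then ((j k).sign : ℝ) * v k else 0)) * sin (i * x) := by
    intro i
    rw [((hA _).mul_right _).tsum_add ((hB _).mul_right _), tsum_mul_right, tsum_mul_right]
  simp only [this]
  ring

/-- Interpolating an absolutely convergent trigonometric series replaces every frequency by its
alias. -/
lemma interp_tsum {n : ℕ} (hn : 1 ≤ n) {u v : ℕ → ℝ} (hu : Summable fun k => |u k|)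
    (hv : Summable fun k => |v k|) {a₀ : ℝ} {f : ℝ → ℝ}
    (hf : ∀ x, f x = a₀ / 2 + ∑' k : ℕ, (u k * cos (((k + 1 : ℕ) : ℝ) * x) +
      v k * sin (((k + 1 : ℕ) : ℝ) * x))) (x : ℝ) :
    interp n f x = a₀ / 2 + ∑' k : ℕ, (u k * cos (aliasFreq n (k + 1) * x) +
      v k * sin (aliasFreq n (k + 1) * x)) := by
  have hper : Function.Periodic f (2 * π) := by
    intro x
    rw [hf, hf]
    congr 1
    refine tsum_congr fun k => ?_
    rw [mul_add, cos_add_nat_mul_two_pi, sin_add_nat_mul_two_pi]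
  refine congrFun (eq_interp hn hper ⟨isTrigPoly_tsum hu hv a₀
    fun k => natAbs_aliasFreq_le hn (k + 1), fun i => ?_⟩).symm x
  rw [hf]
  congr 1
  refine tsum_congr fun k => ?_
  obtain ⟨q, hq⟩ := mul_node_eq hn (k + 1) i
  rw [hq, cos_add_int_mul_two_pi, sin_add_int_mul_two_pi]

/-- The interpolation error of the `n`-th harmonic. -/
lemma harmonic_sub_alias {n : ℕ} (hn : 1 ≤ n) (u v x : ℝ) :
    (u * cos (n * x) + v * sin (n * x)) - (u * cos (aliasFreq n n * x) +
      v * sin (aliasFreq n n * x)) =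
      2 * sin (((2 * n - 1 : ℕ) : ℝ) * x / 2) * (v * cos (x / 2) - u * sin (x / 2)) := by
  rw [aliasFreq_self hn]
  push_cast [Nat.cast_sub hn, Nat.cast_sub (show 1 ≤ 2 * n by omega)]
  rw [show (n : ℝ) * x = (2 * n - 1) * x / 2 + x / 2 by ring,
    show -((n : ℝ) - 1) * x = -((2 * n - 1) * x / 2 - x / 2) by ring, cos_neg, sin_neg,
    cos_add, cos_sub, sin_add, sin_sub]
  ring

/-- The `n`-th harmonic gives the leading term of the interpolation error, the lower ones are
reproduced exactly and every higher one enters with a factor of at most `2`. -/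
lemma abs_error_sub_le {n : ℕ} (hn : 1 ≤ n) {u v : ℕ → ℝ} (hu : Summable fun k => |u k|)
    (hv : Summable fun k => |v k|) {a₀ : ℝ} {f : ℝ → ℝ}
    (hf : ∀ x, f x = a₀ / 2 + ∑' k : ℕ, (u k * cos (((k + 1 : ℕ) : ℝ) * x) +
      v k * sin (((k + 1 : ℕ) : ℝ) * x))) (x : ℝ) :
    |f x - interp n f x - 2 * sin (((2 * n - 1 : ℕ) : ℝ) * x / 2) *
      (v (n - 1) * cos (x / 2) - u (n - 1) * sin (x / 2))| ≤
      2 * ∑' k, (|u (k + n)| + |v (k + n)|) := by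
  obtain ⟨m, rfl⟩ : ∃ m, n = m + 1 := ⟨n - 1, by omega⟩
  have h1 := summable_harmonic hu hv fun k => ((k + 1 : ℕ) : ℝ) * x
  have h2 := summable_harmonic hu hv fun k => (aliasFreq (m + 1) (k + 1) : ℝ) * x
  set d : ℕ → ℝ := fun k => (u k * cos (((k + 1 : ℕ) : ℝ) * x) + v k * sin (((k + 1 : ℕ) : ℝ) * x))
    - (u k * cos (aliasFreq (m + 1) (k + 1) * x) + v k * sin (aliasFreq (m + 1) (k + 1) * x)) with hd
  have hds : Summable d := h1.sub h2
  have hE : f x - interp (m + 1) f x = ∑' k, d k := by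
    rw [hf, interp_tsum hn hu hv hf, hd, h1.tsum_sub h2]
    ring
  have hlow : ∑ k ∈ Finset.range (m + 1), d k = d m := by
    rw [Finset.sum_range_succ, Finset.sum_eq_zero, zero_add]
    intro k hk
    simp only [hd]
    rw [aliasFreq_of_lt (by have := Finset.mem_range.1 hk; omega)]
    simp
  have hdm := harmonic_sub_alias (n := m + 1) hn (u m) (v m) x
  have hdm : d m = _ := hdm
  rw [hE, ← hds.sum_add_tsum_nat_add (m + 1), hlow, hdm, Nat.add_sub_cancel, add_sub_cancel_left]
  have hus := (summable_nat_add_iff (m + 1)).2 hu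
  have hvs := (summable_nat_add_iff (m + 1)).2 hv
  rw [← tsum_mul_left, ← norm_eq_abs]
  refine tsum_of_norm_bounded ((hus.add hvs).mul_left 2).hasSum fun k => ?_
  simp only [hd]
  set K := k + (m + 1)
  refine (norm_sub_le _ _).trans ?_
  simp only [norm_eq_abs]
  linarith [abs_harmonic_le (u K) (v K) (((K + 1 : ℕ) : ℝ) * x),
    abs_harmonic_le (u K) (v K) (aliasFreq (m + 1) (K + 1) * x)]

/-! ### Decay of the coefficients -/

/-- The condition on `n` makes `e^{-αk^r}` decay geometrically with ratio `1 / (n + 1)` from `k = n`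
on. -/
lemma exp_neg_rpow_add_le {α r : ℝ} {n : ℕ} (hα : 0 < α) (hr : 1 < r) (hn : 1 ≤ n)
    (h : (n : ℝ) ^ (1 - r) * log ((n : ℝ) + 1) ≤ α * r) (i : ℕ) :
    exp (-α * ((n + i : ℕ) : ℝ) ^ r) ≤ exp (-α * (n : ℝ) ^ r) * (1 / ((n : ℝ) + 1)) ^ i := by
  have hn0 : (0 : ℝ) < n := by exact_mod_cast hn
  have h1 : log ((n : ℝ) + 1) ≤ α * r * (n : ℝ) ^ (r - 1) := by
    have := mul_le_mul_of_nonneg_right h (rpow_nonneg hn0.le (r - 1))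
    rwa [mul_right_comm, ← rpow_add hn0, show 1 - r + (r - 1) = 0 by ring, rpow_zero, one_mul]
      at this
  have h2 : (n : ℝ) ^ r + r * (n : ℝ) ^ (r - 1) * i ≤ ((n + i : ℕ) : ℝ) ^ r := by
    have hb := one_add_mul_self_le_rpow_one_add (s := (i : ℝ) / n)
      (by have : 0 ≤ (i : ℝ) / n := by positivity
          linarith) hr.le
    have e : ((n + i : ℕ) : ℝ) = n * (1 + i / n) := by push_cast; field_simp
    rw [e, mul_rpow hn0.le (by positivity)]
    refine le_trans (le_of_eq ?_) (mul_le_mul_of_nonneg_left hb (rpow_nonneg hn0.le r))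
    rw [rpow_sub hn0, rpow_one]
    field_simp
  have h3 : (1 / ((n : ℝ) + 1)) ^ i = exp (-(i * log ((n : ℝ) + 1))) := by
    rw [← mul_neg, exp_nat_mul, exp_neg, exp_log (by positivity), one_div]
  rw [h3, ← exp_add]
  refine exp_le_exp.2 ?_
  have h4 := mul_le_mul_of_nonneg_left h2 hα.le
  have h5 := mul_le_mul_of_nonneg_right h1 (Nat.cast_nonneg (α := ℝ) i)
  linarith

lemma hasSum_geometric_tail {n : ℕ} (hn : 1 ≤ n) :
    HasSum (fun i : ℕ => (1 / ((n : ℝ) + 1)) ^ (i + 1)) (1 / n) := by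
  have hn0 : (0 : ℝ) < n := by exact_mod_cast hn
  have := (hasSum_geometric_of_lt_one (r := 1 / ((n : ℝ) + 1)) (by positivity)
    (by rw [div_lt_one (by positivity)]; linarith)).mul_right (1 / ((n : ℝ) + 1))
  simp only [← pow_succ] at this
  have e : (1 - 1 / ((n : ℝ) + 1))⁻¹ * (1 / ((n : ℝ) + 1)) = 1 / n := by
    rw [show 1 - 1 / ((n : ℝ) + 1) = n / (n + 1) by field_simp; ring]
    field_simp
  rwa [e] at this

lemma summable_exp_neg_rpow {α r : ℝ} {n : ℕ} (hα : 0 < α) (hr : 1 < r) (hn : 1 ≤ n)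
    (h : (n : ℝ) ^ (1 - r) * log ((n : ℝ) + 1) ≤ α * r) :
    Summable fun k : ℕ => exp (-α * (k : ℝ) ^ r) := by
  refine (summable_nat_add_iff (n + 1)).1 (Summable.of_nonneg_of_le (fun _ => (exp_pos _).le)
    (fun i => ?_) ((hasSum_geometric_tail hn).summable.mul_left (exp (-α * (n : ℝ) ^ r))))
  have := exp_neg_rpow_add_le hα hr hn h (i + 1)
  rwa [show n + (i + 1) = i + (n + 1) by ring] at this

lemma tsum_exp_neg_rpow_le {α r : ℝ} {n : ℕ} (hα : 0 < α) (hr : 1 < r) (hn : 1 ≤ n)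
    (h : (n : ℝ) ^ (1 - r) * log ((n : ℝ) + 1) ≤ α * r) :
    ∑' i : ℕ, exp (-α * ((i + n + 1 : ℕ) : ℝ) ^ r) ≤ exp (-α * (n : ℝ) ^ r) * (1 / n) := by
  have hg := (hasSum_geometric_tail hn).mul_left (exp (-α * (n : ℝ) ^ r))
  rw [← hg.tsum_eq]
  refine Summable.tsum_le_tsum (fun i => ?_)
    ((summable_nat_add_iff (n + 1)).2 (summable_exp_neg_rpow hα hr hn h)) hg.summable
  have := exp_neg_rpow_add_le hα hr hn h (i + 1)
  rwa [show n + (i + 1) = i + n + 1 by ring] at this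

/-! ### Expansion of the functions of the class -/

lemma IsAdmissible.integrable {φ : ℝ → ℝ} (hφ : IsAdmissible φ) : Integrable φ periodMeasure :=
  memLp_one_iff_integrable.1 hφ.memLp

lemma IsAdmissible.integral_norm_le {φ : ℝ → ℝ} (hφ : IsAdmissible φ) :
    ∫ t, ‖φ t‖ ∂periodMeasure ≤ 1 := by
  rw [integral_norm_eq_lintegral_enorm hφ.integrable.aestronglyMeasurable,
    ← eLpNorm_one_eq_lintegral_enorm]
  exact ENNReal.toReal_le_of_le_ofReal zero_le_one (by simpa using hφ.norm_le)

lemma IsAdmissible.integrable_mul {φ g : ℝ → ℝ} (hφ : IsAdmissible φ) (hg : Continuous g)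
    {K : ℝ} (h : ∀ t, |g t| ≤ K) : Integrable (fun t => g t * φ t) periodMeasure :=
  hφ.integrable.bdd_mul hg.aestronglyMeasurable (Filter.Eventually.of_forall h)

lemma IsAdmissible.integral_norm_mul_le {φ g : ℝ → ℝ} (hφ : IsAdmissible φ) (hg : Continuous g)
    {K : ℝ} (h : ∀ t, |g t| ≤ K) : ∫ t, ‖g t * φ t‖ ∂periodMeasure ≤ K := by
  have hK : 0 ≤ K := (abs_nonneg _).trans (h 0)
  calc ∫ t, ‖g t * φ t‖ ∂periodMeasure ≤ ∫ t, K * ‖φ t‖ ∂periodMeasure := by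
        refine integral_mono (hφ.integrable_mul hg h).norm (hφ.integrable.norm.const_mul K)
          fun t => ?_
        simp only [norm_mul]
        exact mul_le_mul_of_nonneg_right (h t) (norm_nonneg _)
    _ = K * ∫ t, ‖φ t‖ ∂periodMeasure := integral_const_mul _ _
    _ ≤ K := mul_le_of_le_one_right hK hφ.integral_norm_le

lemma IsAdmissible.abs_integral_mul_le {φ g : ℝ → ℝ} (hφ : IsAdmissible φ) (hg : Continuous g)
    {K : ℝ} (h : ∀ t, |g t| ≤ K) : |∫ t, g t * φ t ∂periodMeasure| ≤ K :=
  (norm_integral_le_integral_norm _).trans (hφ.integral_norm_mul_le hg h)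

/-- The integral of `φ(t) cos(kt + πβ_k/2)` over one period. -/
noncomputable def cosCoeff (β : ℕ → ℝ) (φ : ℝ → ℝ) (k : ℕ) : ℝ :=
  ∫ t, cos (k * t + π * β k / 2) * φ t ∂periodMeasure

/-- The integral of `φ(t) sin(kt + πβ_k/2)` over one period. -/
noncomputable def sinCoeff (β : ℕ → ℝ) (φ : ℝ → ℝ) (k : ℕ) : ℝ :=
  ∫ t, sin (k * t + π * β k / 2) * φ t ∂periodMeasure

lemma abs_cosCoeff_le (β : ℕ → ℝ) {φ : ℝ → ℝ} (hφ : IsAdmissible φ) (k : ℕ) :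
    |cosCoeff β φ k| ≤ 1 :=
  hφ.abs_integral_mul_le (by fun_prop) fun _ => abs_cos_le_one _

lemma abs_sinCoeff_le (β : ℕ → ℝ) {φ : ℝ → ℝ} (hφ : IsAdmissible φ) (k : ℕ) :
    |sinCoeff β φ k| ≤ 1 :=
  hφ.abs_integral_mul_le (by fun_prop) fun _ => abs_sin_le_one _

lemma integral_cos_sub_mul (β : ℕ → ℝ) {φ : ℝ → ℝ} (hφ : IsAdmissible φ) (k : ℕ) (x : ℝ) :
    ∫ t, cos (k * (x - t) - π * β k / 2) * φ t ∂periodMeasure =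
      cosCoeff β φ k * cos (k * x) + sinCoeff β φ k * sin (k * x) := by
  rw [cosCoeff, sinCoeff, ← integral_mul_const, ← integral_mul_const, ← integral_add]
  · refine integral_congr_ae (Filter.Eventually.of_forall fun t => ?_)
    simp only
    rw [show k * (x - t) - π * β k / 2 = k * x - (k * t + π * β k / 2) by ring, cos_sub]
    ring
  · exact (hφ.integrable_mul (by fun_prop) fun _ => abs_cos_le_one _).mul_const _
  · exact (hφ.integrable_mul (by fun_prop) fun _ => abs_sin_le_one _).mul_const _

lemma convolution_eq_tsum {ψ : ℕ → ℝ} (hψ0 : ∀ k, 0 ≤ ψ k) (hψ : Summable ψ) (β : ℕ → ℝ)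
    {φ : ℝ → ℝ} (hφ : IsAdmissible φ) (x : ℝ) :
    (1 / π) * ∫ t in (0 : ℝ)..(2 * π), kernel ψ β (x - t) * φ t =
      ∑' k : ℕ, (ψ (k + 1) / π * cosCoeff β φ (k + 1) * cos (((k + 1 : ℕ) : ℝ) * x) +
        ψ (k + 1) / π * sinCoeff β φ (k + 1) * sin (((k + 1 : ℕ) : ℝ) * x)) := by
  set g : ℕ → ℝ → ℝ := fun k t =>
    ψ (k + 1) * cos (((k + 1 : ℕ) : ℝ) * (x - t) - π * β (k + 1) / 2) with hg
  have hgc : ∀ k, Continuous (g k) := fun k => by simp only [hg]; fun_prop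
  have hgb : ∀ k t, |g k t| ≤ ψ (k + 1) := fun k t => by
    simp only [hg]
    rw [abs_mul, abs_of_nonneg (hψ0 _)]
    exact mul_le_of_le_one_right (hψ0 _) (abs_cos_le_one _)
  have hsum := hasSum_integral_of_summable_integral_norm (μ := periodMeasure)
    (F := fun k t => g k t * φ t) (fun k => hφ.integrable_mul (hgc k) (hgb k))
    (Summable.of_nonneg_of_le (fun k => integral_nonneg fun t => norm_nonneg _)
      (fun k => hφ.integral_norm_mul_le (hgc k) (hgb k)) ((summable_nat_add_iff 1).2 hψ))
  have e1 : ∫ t in (0 : ℝ)..(2 * π), kernel ψ β (x - t) * φ t =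
      ∫ t, ∑' k, g k t * φ t ∂periodMeasure := by
    rw [← integral_periodMeasure]
    refine integral_congr_ae (Filter.Eventually.of_forall fun t => ?_)
    simp only [kernel, hg, tsum_mul_right]
  rw [e1, ← hsum.tsum_eq, ← tsum_mul_left]
  refine tsum_congr fun k => ?_
  simp only [hg, mul_assoc (ψ (k + 1)), integral_const_mul, integral_cos_sub_mul β hφ (k + 1) x]
  ring

lemma continuous_harmonic_tsum {u v : ℕ → ℝ} (hu : Summable fun k => |u k|)
    (hv : Summable fun k => |v k|) (ω : ℕ → ℝ) :
    Continuous fun x => ∑' k, (u k * cos (ω k * x) + v k * sin (ω k * x)) := by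
  refine continuous_tsum (fun k => by fun_prop) (hu.add hv) fun k x => ?_
  exact abs_harmonic_le _ _ _

/-! ### The interpolation error -/

lemma exists_polar (c s : ℝ) : ∃ ρ θ : ℝ, 0 ≤ ρ ∧ c = -(ρ * cos θ) ∧ s = ρ * sin θ := by
  refine ⟨‖(⟨-c, s⟩ : ℂ)‖, Complex.arg ⟨-c, s⟩, norm_nonneg _, ?_, ?_⟩
  · rw [Complex.norm_mul_cos_arg, neg_neg]
  · rw [Complex.norm_mul_sin_arg]

/-- The interpolation error of a function of the class is a multiple of the profile up to an
error that is uniformly `O(1/n)` relative to `e^{-αn^r}`. -/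
lemma exists_profile_approx {α r : ℝ} {n : ℕ} (hα : 0 < α) (hr : 1 < r) (hn : 1 ≤ n)
    (h : (n : ℝ) ^ (1 - r) * log ((n : ℝ) + 1) ≤ α * r) (β : ℕ → ℝ) {φ : ℝ → ℝ}
    (hφ : IsAdmissible φ) {a₀ : ℝ} {f : ℝ → ℝ}
    (hf : ∀ x, f x = a₀ / 2 + (1 / π) * ∫ t in (0 : ℝ)..(2 * π),
      kernel (fun k => exp (-α * (k : ℝ) ^ r)) β (x - t) * φ t) :
    Continuous (fun x => f x - interp n f x) ∧
    ∃ ρ θ : ℝ, |cosCoeff β φ n| ≤ ρ ∧ ρ ≤ 1 ∧ ∀ x, |f x - interp n f x -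
      2 * exp (-α * (n : ℝ) ^ r) / π * ρ * profile (2 * n - 1) θ x| ≤
        4 / π * (exp (-α * (n : ℝ) ^ r) * (1 / n)) := by
  set ψ : ℕ → ℝ := fun k => exp (-α * (k : ℝ) ^ r) with hψ
  have hψ0 : ∀ k, 0 ≤ ψ k := fun k => (exp_pos _).le
  have hψs : Summable ψ := summable_exp_neg_rpow hα hr hn h
  set u : ℕ → ℝ := fun k => ψ (k + 1) / π * cosCoeff β φ (k + 1) with hu
  set v : ℕ → ℝ := fun k => ψ (k + 1) / π * sinCoeff β φ (k + 1) with hv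
  have hub : ∀ k, |u k| ≤ ψ (k + 1) / π := fun k => by
    have := hψ0 (k + 1)
    have hp : 0 ≤ ψ (k + 1) / π := by positivity
    simp only [hu]
    rw [abs_mul, abs_of_nonneg hp]
    exact mul_le_of_le_one_right hp (abs_cosCoeff_le β hφ _)
  have hvb : ∀ k, |v k| ≤ ψ (k + 1) / π := fun k => by
    have := hψ0 (k + 1)
    have hp : 0 ≤ ψ (k + 1) / π := by positivity
    simp only [hv]
    rw [abs_mul, abs_of_nonneg hp]
    exact mul_le_of_le_one_right hp (abs_sinCoeff_le β hφ _)
  have hs1 : Summable fun k => ψ (k + 1) / π := ((summable_nat_add_iff 1).2 hψs).div_const π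
  have hus : Summable fun k => |u k| := Summable.of_nonneg_of_le (fun _ => abs_nonneg _) hub hs1
  have hvs : Summable fun k => |v k| := Summable.of_nonneg_of_le (fun _ => abs_nonneg _) hvb hs1
  have hf' : ∀ x, f x = a₀ / 2 + ∑' k : ℕ, (u k * cos (((k + 1 : ℕ) : ℝ) * x) +
      v k * sin (((k + 1 : ℕ) : ℝ) * x)) := fun x => by
    rw [hf, convolution_eq_tsum hψ0 hψs β hφ]
  refine ⟨?_, ?_⟩
  · simp only [interp_tsum hn hus hvs hf', hf']
    exact (continuous_const.add (continuous_harmonic_tsum hus hvs _)).sub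
      (continuous_const.add (continuous_harmonic_tsum hus hvs _))
  obtain ⟨ρ, θ, hρ, hc, hs⟩ := exists_polar (cosCoeff β φ n) (sinCoeff β φ n)
  refine ⟨ρ, θ, ?_, ?_, fun x => ?_⟩
  · rw [hc, abs_neg, abs_mul, abs_of_nonneg hρ]
    exact mul_le_of_le_one_right hρ (abs_cos_le_one _)
  · -- The amplitude is itself the integral of `φ` against a single cosine.
    have e : ∫ t, cos (n * t + π * β n / 2 + θ) * φ t ∂periodMeasure = -ρ := by
      have : -ρ = cosCoeff β φ n * cos θ - sinCoeff β φ n * sin θ := by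
        rw [hc, hs]
        linear_combination ρ * sin_sq_add_cos_sq θ
      rw [this, cosCoeff, sinCoeff, ← integral_mul_const, ← integral_mul_const, ← integral_sub]
      · refine integral_congr_ae (Filter.Eventually.of_forall fun t => ?_)
        simp only [cos_add _ θ]
        ring
      · exact (hφ.integrable_mul (by fun_prop) fun _ => abs_cos_le_one _).mul_const _
      · exact (hφ.integrable_mul (by fun_prop) fun _ => abs_sin_le_one _).mul_const _
    have := hφ.abs_integral_mul_le (g := fun t => cos (n * t + π * β n / 2 + θ)) (by fun_prop)
      fun _ => abs_cos_le_one _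
    rw [e, abs_neg] at this
    exact (le_abs_self _).trans this
  · have hmain := abs_error_sub_le hn hus hvs hf' x
    have e1 : 2 * sin (((2 * n - 1 : ℕ) : ℝ) * x / 2) *
        (v (n - 1) * cos (x / 2) - u (n - 1) * sin (x / 2)) =
        2 * ψ n / π * ρ * profile (2 * n - 1) θ x := by
      simp only [hu, hv, Nat.sub_add_cancel hn, hc, hs, profile, sin_add]
      ring
    rw [e1] at hmain
    refine hmain.trans ?_
    have h1 : Summable fun k => |u (k + n)| + |v (k + n)| :=
      ((summable_nat_add_iff n).2 hus).add ((summable_nat_add_iff n).2 hvs)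
    have h2 : Summable fun k => ψ (k + n + 1) := (summable_nat_add_iff (n + 1)).2 hψs
    have h3 : ∑' k, (|u (k + n)| + |v (k + n)|) ≤ ∑' k, 2 / π * ψ (k + n + 1) := by
      refine h1.tsum_le_tsum (fun k => ?_) (h2.mul_left _)
      have := add_le_add (hub (k + n)) (hvb (k + n))
      refine this.trans (le_of_eq ?_)
      ring
    rw [tsum_mul_left] at h3
    have h4 : ∑' k, ψ (k + n + 1) ≤ ψ n * (1 / n) := tsum_exp_neg_rpow_le hα hr hn h
    have h5 := mul_le_mul_of_nonneg_left h4 (show 0 ≤ 2 / π by positivity)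
    calc _ ≤ 2 * (2 / π * (ψ n * (1 / n))) := by linarith
      _ = _ := by ring

/-! ### A nearly extremal function -/

lemma integral_cos_pow_even_pos (m : ℕ) : 0 < ∫ x in (0 : ℝ)..(2 * π), cos x ^ (2 * m) := by
  refine intervalIntegral.integral_pos two_pi_pos (by fun_prop)
    (fun x _ => (even_two_mul m).pow_nonneg _) ⟨0, ⟨le_rfl, two_pi_pos.le⟩, by simp⟩

lemma integral_cos_pow_even_comp {n : ℕ} (hn : 1 ≤ n) (γ : ℝ) (m : ℕ) :
    ∫ t in (0 : ℝ)..(2 * π), cos (n * t + γ) ^ (2 * m) =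
      ∫ x in (0 : ℝ)..(2 * π), cos x ^ (2 * m) := by
  have hper : Function.Periodic (fun x => cos x ^ (2 * m)) π := fun x => by
    simp only [cos_add_pi, (even_two_mul m).neg_pow]
  rw [← integral_comp_half_mul_add (by fun_prop) hper (N := 2 * n) (by omega) γ]
  refine intervalIntegral.integral_congr fun t _ => ?_
  exact congrArg (fun y => cos y ^ (2 * m)) (by push_cast; ring)

/-- High odd powers of `cos(nt + γ)`, normalised, nearly attain the largest possible integral
against `cos(nt + γ)`. -/
noncomputable def nearExtremal (n : ℕ) (γ t : ℝ) : ℝ :=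
  cos (n * t + γ) ^ (2 * n + 1) / ∫ x in (0 : ℝ)..(2 * π), cos x ^ (2 * n)

lemma continuous_nearExtremal (n : ℕ) (γ : ℝ) : Continuous (nearExtremal n γ) := by
  unfold nearExtremal
  fun_prop

lemma periodic_nearExtremal (n : ℕ) (γ : ℝ) : Function.Periodic (nearExtremal n γ) (2 * π) := by
  intro t
  rw [nearExtremal, nearExtremal,
    show (n : ℝ) * (t + 2 * π) + γ = n * t + γ + n * (2 * π) by ring, cos_add_nat_mul_two_pi]

lemma isAdmissible_nearExtremal {n : ℕ} (hn : 1 ≤ n) (γ : ℝ) :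
    IsAdmissible (nearExtremal n γ) := by
  have hn0 : (n : ℝ) ≠ 0 := by positivity
  have hW := integral_cos_pow_even_pos n
  set W := ∫ x in (0 : ℝ)..(2 * π), cos x ^ (2 * n) with hWdef
  have hle : ∀ t, ‖nearExtremal n γ t‖ ≤ cos (n * t + γ) ^ (2 * n) / W := fun t => by
    rw [nearExtremal, norm_div, norm_eq_abs, norm_eq_abs, abs_of_pos hW]
    gcongr
    rw [pow_succ, abs_mul, abs_of_nonneg ((even_two_mul n).pow_nonneg _)]
    exact mul_le_of_le_one_right ((even_two_mul n).pow_nonneg _) (abs_cos_le_one _)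
  have hmem : MemLp (nearExtremal n γ) 1 periodMeasure := by
    refine MemLp.of_bound (continuous_nearExtremal n γ).aestronglyMeasurable (1 / W)
      (Filter.Eventually.of_forall fun t => (hle t).trans ?_)
    gcongr
    rw [pow_mul]
    exact pow_le_one₀ (sq_nonneg _) (cos_sq_le_one _)
  refine ⟨periodic_nearExtremal n γ, hmem, ?_, ?_⟩
  · have hint := memLp_one_iff_integrable.1 hmem
    rw [eLpNorm_one_eq_lintegral_enorm, ← ofReal_integral_norm_eq_lintegral_enorm hint,
      ENNReal.ofReal_le_one, integral_periodMeasure]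
    calc ∫ t in (0 : ℝ)..(2 * π), ‖nearExtremal n γ t‖
        ≤ ∫ t in (0 : ℝ)..(2 * π), cos (n * t + γ) ^ (2 * n) / W :=
          intervalIntegral.integral_mono_on two_pi_pos.le
            ((continuous_nearExtremal n γ).norm.intervalIntegrable _ _)
            (Continuous.intervalIntegrable (by fun_prop) _ _) fun t _ => hle t
      _ = 1 := by
          rw [intervalIntegral.integral_div, integral_cos_pow_even_comp hn, div_self hW.ne']
  · -- The function changes sign under translation by `π / n`, a fraction of its period `2π`.
    have hshift : ∀ t, nearExtremal n γ (t + π / n) = -nearExtremal n γ t := fun t => by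
      rw [nearExtremal, nearExtremal,
        show (n : ℝ) * (t + π / n) + γ = n * t + γ + π by field_simp; ring, cos_add_pi,
        Odd.neg_pow ⟨n, rfl⟩, neg_div]
    have h1 := (periodic_nearExtremal n γ).intervalIntegral_add_eq (0 + π / n) 0
    have h2 := intervalIntegral.integral_comp_add_right (a := 0) (b := 2 * π)
      (nearExtremal n γ) (π / n)
    simp only [hshift, intervalIntegral.integral_neg] at h2
    rw [show 2 * π + π / n = 0 + π / n + 2 * π by ring, h1, zero_add] at h2
    linarith

lemma cosCoeff_nearExtremal {n : ℕ} (hn : 1 ≤ n) (β : ℕ → ℝ) :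
    cosCoeff β (nearExtremal n (π * β n / 2)) n = (2 * n + 1) / (2 * n + 2) := by
  have hW := integral_cos_pow_even_pos n
  have e : ∀ t, cos (n * t + π * β n / 2) * nearExtremal n (π * β n / 2) t =
      cos (n * t + π * β n / 2) ^ (2 * (n + 1)) / ∫ x in (0 : ℝ)..(2 * π), cos x ^ (2 * n) :=
    fun t => by rw [nearExtremal]; ring
  rw [cosCoeff, integral_periodMeasure]
  simp only [e]
  rw [intervalIntegral.integral_div, integral_cos_pow_even_comp hn,
    show 2 * (n + 1) = 2 * n + 2 by ring, integral_cos_pow]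
  simp only [sin_two_pi, sin_zero, mul_zero, sub_zero, zero_div, zero_add]
  push_cast
  rw [mul_div_assoc, div_self hW.ne', mul_one]

/-! ### The asymptotic formula -/

lemma leading_constant_eq (s c : ℝ) :
    (2 : ℝ) ^ (1 - s) / π ^ (1 + s) * c ^ 2 = 2 / π * (c ^ 2 / (2 * π) ^ s) := by
  rw [rpow_sub two_pos, rpow_add pi_pos, mul_rpow two_pos.le pi_pos.le, rpow_one, rpow_one]
  have h2 : (0 : ℝ) < 2 ^ s := by positivity
  have h3 : 0 < π ^ s := by positivity
  field_simp

/-- The norm of the interpolation error is determined, up to `O(e^{-αn^r}/n)`, by the amplitude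
`ρ`. -/
lemma exists_abs_perNorm_error_sub_le {α r : ℝ} {n : ℕ} (hα : 0 < α) (hr : 1 < r) (hn : 1 ≤ n)
    (h : (n : ℝ) ^ (1 - r) * log ((n : ℝ) + 1) ≤ α * r) (β : ℕ → ℝ) {p : ℝ≥0∞} (hp : 1 ≤ p)
    {φ : ℝ → ℝ} (hφ : IsAdmissible φ) {a₀ : ℝ} {f : ℝ → ℝ}
    (hf : ∀ x, f x = a₀ / 2 + (1 / π) * ∫ t in (0 : ℝ)..(2 * π),
      kernel (fun k => exp (-α * (k : ℝ) ^ r)) β (x - t) * φ t) :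
    eLpNorm (fun x => f x - interp n f x) p periodMeasure ≠ ∞ ∧
    ∃ ρ : ℝ, |cosCoeff β φ n| ≤ ρ ∧ ρ ≤ 1 ∧
      |perNorm p (fun x => f x - interp n f x) - exp (-α * (n : ℝ) ^ r) *
        (ρ * ((2 : ℝ) ^ (1 - (p⁻¹).toReal) / π ^ (1 + (p⁻¹).toReal) * cosNorm p ^ 2))| ≤
        exp (-α * (n : ℝ) ^ r) * ((4 * π + 8) * (1 / n)) := by
  obtain ⟨hcont, ρ, θ, hcρ, hρ1, hE⟩ := exists_profile_approx hα hr hn h β hφ hf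
  have hn0 : (0 : ℝ) < n := by exact_mod_cast hn
  have hρ0 : 0 ≤ ρ := (abs_nonneg _).trans hcρ
  set Q := exp (-α * (n : ℝ) ^ r) with hQ
  have hQ0 : 0 < Q := exp_pos _
  set N := 2 * n - 1 with hN
  have hN1 : 1 ≤ N := by omega
  set A := 2 * Q / π * ρ with hA
  have hA0 : 0 ≤ A := by positivity
  set E : ℝ → ℝ := fun x => f x - interp n f x with hEdef
  set K := 4 / π * (Q * (1 / n)) with hK
  have hPb : ∀ x, |A * profile N θ x| ≤ A := fun x => by
    rw [abs_mul, abs_of_nonneg hA0]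
    exact mul_le_of_le_one_right hA0 (abs_profile_le N θ x)
  have hEb : ∀ x, |E x| ≤ A + K := fun x => by
    have h1 := abs_add_le (E x - A * profile N θ x) (A * profile N θ x)
    rw [sub_add_cancel] at h1
    linarith [hE x, hPb x]
  refine ⟨eLpNorm_ne_top_of_abs_le hp hEb, ρ, hcρ, hρ1, ?_⟩
  have hPc : Continuous fun x => A * profile N θ x := (continuous_profile N θ).const_mul A
  have h1 := perNorm_le_add hp hcont hPc hPb hE
  have h2 := perNorm_le_add hp hPc hcont hEb fun x => by rw [abs_sub_comm]; exact hE x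
  rw [perNorm_const_mul, abs_of_nonneg hA0] at h1 h2
  have hL := abs_perNorm_profile_sub_le hp hN1 θ
  set M := cosNorm p ^ 2 / (2 * π) ^ (p⁻¹).toReal with hM
  have hL2 : |A * perNorm p (profile N θ) - A * M| ≤ Q * (4 * π * (1 / n)) := by
    rw [← mul_sub, abs_mul, abs_of_nonneg hA0]
    have hNn : (n : ℝ) ≤ N := by exact_mod_cast (by omega : n ≤ N)
    have hD : 2 * π * (π / N) ≤ 2 * π * (π / n) := by gcongr
    have hA1 : A ≤ 2 * Q / π := mul_le_of_le_one_right (by positivity) hρ1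
    calc A * _ ≤ 2 * Q / π * (2 * π * (π / n)) :=
          mul_le_mul hA1 (hL.trans hD) (abs_nonneg _) (by positivity)
      _ = Q * (4 * π * (1 / n)) := by field_simp; ring
  have hK2 : 2 * π * K = Q * (8 * (1 / n)) := by rw [hK]; field_simp; ring
  have hconst : Q * (ρ * (2 / π * M)) = A * M := by rw [hA]; ring
  rw [leading_constant_eq, hconst]
  rw [hK2] at h1 h2
  have hL3 := abs_le.1 hL2
  rw [abs_le]
  constructor <;> linarith [hL3.1, hL3.2]

/-- Comparison with the profile for `N = 1` bounds the leading constant independently of `p`. -/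
lemma leading_constant_bounds {p : ℝ≥0∞} (hp : 1 ≤ p) :
    0 ≤ (2 : ℝ) ^ (1 - (p⁻¹).toReal) / π ^ (1 + (p⁻¹).toReal) * cosNorm p ^ 2 ∧
    (2 : ℝ) ^ (1 - (p⁻¹).toReal) / π ^ (1 + (p⁻¹).toReal) * cosNorm p ^ 2 ≤ 4 * π + 4 := by
  refine ⟨by positivity, ?_⟩
  rw [leading_constant_eq]
  have h1 := (abs_le.1 (abs_perNorm_profile_sub_le hp (N := 1) le_rfl 0)).1
  have h2 := perNorm_profile_le hp 1 0
  have h3 : cosNorm p ^ 2 / (2 * π) ^ (p⁻¹).toReal ≤ 2 * π + 2 * π * π := by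
    push_cast at h1
    linarith
  calc _ ≤ 2 / π * (2 * π + 2 * π * π) := by gcongr
    _ = 4 * π + 4 := by field_simp; ring

end TrigInterp

theorem mainTheorem2 :
    ∃ C : ℝ, ∀ (α r : ℝ) (p : ℝ≥0∞) (β : ℕ → ℝ) (n : ℕ),
      0 < α → 1 < r → 1 ≤ p → 1 ≤ n →
      (n : ℝ) ^ (1 - r) * Real.log ((n : ℝ) + 1) ≤ α * r →
      TrigInterp.interpError n p (TrigInterp.poissonClass α r β) ≠ ∞ ∧
      ∃ θ : ℝ, |θ| ≤ C ∧
        (TrigInterp.interpError n p (TrigInterp.poissonClass α r β)).toReal =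
          Real.exp (-α * (n : ℝ) ^ r) *
            ((2 : ℝ) ^ (1 - (p⁻¹).toReal) / Real.pi ^ (1 + (p⁻¹).toReal) *
                TrigInterp.cosNorm p ^ 2 + θ * (1 / (n : ℝ))) := by
  -- `4π + 8` comes from the norm of the profile and the remainder of the error; a further `4π + 4`,
  -- a bound for the leading constant, is lost because the amplitude `ρ` only reaches `1 - 1/n`.
  refine ⟨8 * Real.pi + 12, fun α r p β n hα hr hp hn h => ?_⟩
  have hn0 : (0 : ℝ) < n := by exact_mod_cast hn
  obtain ⟨hB0, hB⟩ := TrigInterp.leading_constant_bounds hp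
  set B := (2 : ℝ) ^ (1 - (p⁻¹).toReal) / Real.pi ^ (1 + (p⁻¹).toReal) *
    TrigInterp.cosNorm p ^ 2 with hBdef
  set Q := Real.exp (-α * (n : ℝ) ^ r) with hQ
  have hQ0 : 0 < Q := Real.exp_pos _
  have hpi := Real.pi_pos
  set I := TrigInterp.interpError n p (TrigInterp.poissonClass α r β) with hI
  have hupper : I ≤ ENNReal.ofReal (Q * (B + (4 * Real.pi + 8) * (1 / n))) := by
    refine iSup₂_le fun f hf => ?_
    obtain ⟨a₀, φ, hφ, hf⟩ := hf
    obtain ⟨hfin, ρ, hρ, hρ1, hE⟩ :=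
      TrigInterp.exists_abs_perNorm_error_sub_le hα hr hn h β hp hφ hf
    rw [ENNReal.le_ofReal_iff_toReal_le hfin (by positivity)]
    have h1 := (abs_le.1 hE).2
    have h2 : Q * (ρ * B) ≤ Q * B := by gcongr; exact mul_le_of_le_one_left hB0 hρ1
    unfold TrigInterp.perNorm at h1
    rw [mul_add]
    linarith
  have htop : I ≠ ∞ := (hupper.trans_lt ENNReal.ofReal_lt_top).ne
  have hle : I.toReal ≤ Q * (B + (4 * Real.pi + 8) * (1 / n)) :=
    ENNReal.toReal_le_of_le_ofReal (by positivity) hupper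
  have hge : Q * (B - (8 * Real.pi + 12) * (1 / n)) ≤ I.toReal := by
    have hφ := TrigInterp.isAdmissible_nearExtremal hn (Real.pi * β n / 2)
    set f : ℝ → ℝ := fun x => 0 / 2 + (1 / Real.pi) * ∫ t in (0 : ℝ)..(2 * Real.pi),
      TrigInterp.kernel (fun k => Real.exp (-α * (k : ℝ) ^ r)) β (x - t) *
        TrigInterp.nearExtremal n (Real.pi * β n / 2) t with hfdef
    obtain ⟨hfin, ρ, hρ, hρ1, hE⟩ := TrigInterp.exists_abs_perNorm_error_sub_le hα hr hn h β hp hφ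
      (f := f) fun x => rfl
    have hmem : f ∈ TrigInterp.poissonClass α r β := ⟨0, _, hφ, fun x => rfl⟩
    have h0 : MeasureTheory.eLpNorm (fun x => f x - TrigInterp.interp n f x) p
        TrigInterp.periodMeasure ≤ I :=
      le_iSup₂ (f := fun f _ => MeasureTheory.eLpNorm (fun x => f x - TrigInterp.interp n f x) p
        TrigInterp.periodMeasure) f hmem
    have h0' := ENNReal.toReal_mono htop h0
    have h1 := (abs_le.1 hE).1
    unfold TrigInterp.perNorm at h1
    have h2 : 1 - 1 / n ≤ ρ := by
      refine le_trans ?_ ((le_abs_self _).trans hρ)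
      rw [TrigInterp.cosCoeff_nearExtremal hn, le_div_iff₀ (by positivity), sub_mul,
        div_mul_eq_mul_div, sub_le_iff_le_add]
      have : (1 : ℝ) ≤ 1 * (2 * n + 2) / n := by rw [le_div_iff₀ hn0]; linarith
      linarith
    have h3 : B - (4 * Real.pi + 4) * (1 / n) ≤ ρ * B := by
      have h4 : (1 - 1 / (n : ℝ)) * B ≤ ρ * B := by gcongr
      have h5 : B * (1 / (n : ℝ)) ≤ (4 * Real.pi + 4) * (1 / n) := by gcongr
      linarith
    have h6 := mul_le_mul_of_nonneg_left h3 hQ0.le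
    linarith
  refine ⟨htop, n * (I.toReal / Q - B), ?_, ?_⟩
  · -- Dividing the two bounds by `Q` confines `I / Q - B` to an interval of length `O(1/n)`.
    rw [abs_mul, abs_of_pos hn0, ← le_div_iff₀' hn0, abs_le]
    have h1 := (div_le_iff₀' hQ0).2 hle
    have h2 := (le_div_iff₀' hQ0).2 hge
    have h3 : (4 * Real.pi + 8) * (1 / (n : ℝ)) ≤ (8 * Real.pi + 12) * (1 / n) := by
      gcongr <;> linarith
    rw [mul_one_div (8 * Real.pi + 12)] at h2 h3
    constructor <;> linarith
  · field_simp
    ring
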